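/- All spaces are Hausdorff (so "regular" includes Hausdorff) and all maps are continuous. The closed long ray $\mathbb{L}_{\ge 0}$ is $\omega_1\times[0,1)$ with the order topology of the lexicographic order, and $\alpha\in\omega_1$ is identified with $\langle\alpha,0\rangle\in\mathbb{L}_{\ge 0}$. A space $X$ is of Type I if $X=\bigcup_{\alpha<\omega_1}X_\alpha$, where each $X_\alpha$ is open, each closure $\overline{X_\alpha}$ is Lindelöf, and $\overline{X_\alpha}\subset X_\beta$ whenever $\alpha<\beta<\omega_1$. A subset of $X$ is bounded if it is contained in some $X_\alpha$; a subset of $\mathbb{L}_{\ge 0}$ is bounded if it has an upper bound. A closed set $D\subset X$ is functionally narrow in $X$ if for every continuous $f:X\to\mathbb{L}_{\ge 0}$ with $f(D)$ unbounded, (a) the set of $\alpha<\omega_1$ such that $f(D\setminus X_\alpha)\subset[\alpha,\omega_1)=\{y\in\mathbb{L}_{\ge0}: y\ge\alpha\}$ is closed and unbounded in $\omega_1$, and (b) $f^{-1}(\{0\})\cap D$ is bounded in $X$. **Theorem.** Let $X=\bigcup_{\alpha<\omega_1}X_\alpha$ be a regular space of Type I, and let $D\subset X$ be a closed, non-Lindelöf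 subset that is functionally narrow in $X$. Then $X$ is not homotopy equivalent to a CW-complex. -/

import Mathlib

open Set Topology
open scoped Ordinal ContinuousMap

universe u v

/-- The first uncountable ordinal `ω₁`, as the type of all countable ordinals. -/
abbrev Omega1 : Type 1 := Iio (ω₁ : Ordinal.{0})

/-- The closed long ray: the product `ω₁ × [0, 1)` with the lexicographic order (and, below, the
topology of that order). -/
def LongRay : Type 1 := Omega1 ×ₗ Ico (0 : ℝ) 1

namespace LongRay

noncomputable instance : LinearOrder LongRay :=
  inferInstanceAs (LinearOrder (Omega1 ×ₗ Ico (0 : ℝ) 1))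

noncomputable instance : TopologicalSpace LongRay := Preorder.topology LongRay

instance : OrderTopology LongRay := ⟨rfl⟩

/-- The point `⟨α, 0⟩` of the long ray, with which the ordinal `α < ω₁` is identified. -/
def ofOrdinal (α : Omega1) : LongRay :=
  toLex (α, ⟨0, left_mem_Ico.2 zero_lt_one⟩)

/-- The end point `0 = ⟨0, 0⟩` of the long ray. -/
instance : Zero LongRay := ⟨ofOrdinal ⟨0, Ordinal.omega_pos 1⟩⟩

end LongRay

/-- `U` witnesses that the space `X` is of Type I: `X` is the union of the open sets `U α`, `α < ω₁`,
each `U α` has Lindelöf closure, and the closure of `U α` lies in `U β` whenever `α < β`. -/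
structure IsTypeICover {X : Type*} [TopologicalSpace X] (U : Omega1 → Set X) : Prop where
  isOpen (α : Omega1) : IsOpen (U α)
  isLindelof_closure (α : Omega1) : IsLindelof (closure (U α))
  closure_subset {α β : Omega1} (h : α < β) : closure (U α) ⊆ U β
  iUnion_eq : ⋃ α, U α = univ

/-- `D` is functionally narrow in the Type I space `X = ⋃ α < ω₁, U α`: for every continuous
`f : X → LongRay` which is unbounded on `D`,
* the set of those `α < ω₁` for which `f (D \ U α) ⊆ [α, ω₁)` is closed and unbounded in `ω₁`, and
* `f ⁻¹ {0} ∩ D` is bounded in `X`, that is, contained in some `U α`. -/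
structure FunctionallyNarrow {X : Type*} [TopologicalSpace X] (U : Omega1 → Set X) (D : Set X) :
    Prop where
  isClub (f : C(X, LongRay)) (hf : ¬ BddAbove (f '' D)) :
    IsClub {α : Omega1 | f '' (D \ U α) ⊆ Ici (LongRay.ofOrdinal α)}
  zero_bounded (f : C(X, LongRay)) (hf : ¬ BddAbove (f '' D)) :
    ∃ α : Omega1, f ⁻¹' {0} ∩ D ⊆ U α

/-- `X` is homotopy equivalent to a CW-complex (a Hausdorff space with a CW structure). -/
def HomotopyEquivalentToCWComplex (X : Type u) [TopologicalSpace X] : Prop :=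
  ∃ (W : Type v) (_ : TopologicalSpace W), T2Space W ∧
    Nonempty (CWComplex (univ : Set W)) ∧ Nonempty (X ≃ₕ W)

/-! Regularity and Type I yield a map `s : X → LongRay` with `s x ≥ α` off `U α`
(`IsTypeICover.exists_map`); it is unbounded on `D`, since `D` lies in no `U α`. If `X` were
equivalent to a CW complex `W`, then `s` would factor through `W` up to homotopy. Every map `W →
LongRay` is null-homotopic (`LongRay.homotopic_zero_of_cwComplex`): compact sets have bounded image,
and initial segments of the long ray are intervals, so homotopies extend over cells. Hence `s` would
be homotopic to `0`. But along a homotopy the times at which the map is bounded on `D` form a clopen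
subset of `[0, 1]`, by the club condition (`FunctionallyNarrow.not_bddAbove_of_homotopic`), a
contradiction. -/

/-! ### Countable ordinals. -/

theorem Omega1.countable_Iio (α : Omega1) : (Iio α).Countable := by
  have h : (Iio (α : Ordinal.{0})).Countable := by
    rw [← Cardinal.le_aleph0_iff_set_countable, Cardinal.mk_Iio_ordinal]
    have h2 : (α : Ordinal.{0}).card < Cardinal.aleph 1 := by
      rw [← Cardinal.lt_ord, Cardinal.ord_aleph]
      exact α.2
    rw [← Cardinal.succ_aleph0, Order.lt_succ_iff] at h2
    rw [← Cardinal.lift_aleph0.{1, 0}, Cardinal.lift_le]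
    exact h2
  exact (h.preimage Subtype.val_injective).mono fun β hβ => hβ

theorem Omega1.exists_covBy (α : Omega1) : ∃ β, α ⋖ β :=
  ⟨⟨Order.succ α.1, (Cardinal.isSuccLimit_omega 1).succ_lt α.2⟩, Order.lt_succ α.1,
    fun γ h h' => (Order.lt_succ_iff.1 (show γ.1 < Order.succ α.1 from h')).not_gt h⟩

/-- This is what makes countable intersections of clubs club. -/
theorem Omega1.cof_ne_aleph0 : Order.cof Omega1 ≠ Cardinal.aleph0 := by
  rw [Ordinal.cof_Iio, Ordinal.lift_omega, Ordinal.lift_one, Cardinal.cof_omega_one]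
  exact (Cardinal.aleph0_lt_aleph_one).ne'

theorem Omega1.bddAbove_range {ι : Type*} [Countable ι] (f : ι → Omega1) :
    BddAbove (range f) := by
  refine ⟨⟨⨆ i, (f i : Ordinal.{0}), Ordinal.iSup_lt_omega_one fun i => (f i).2⟩, ?_⟩
  rintro _ ⟨i, rfl⟩
  exact le_ciSup (f := fun i => (f i : Ordinal.{0})) ⟨ω₁, by rintro _ ⟨j, rfl⟩; exact (f j).2.le⟩ i

/-! ### The long ray: interval coordinates and extension of maps. -/

namespace LongRay

/-- The point of the long ray with given coordinates. -/
def mk (α : Omega1) (t : Ico (0 : ℝ) 1) : LongRay := toLex (α, t)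

theorem exists_eq_mk (x : LongRay) : ∃ α t, x = mk α t := ⟨(ofLex x).1, (ofLex x).2, rfl⟩

theorem mk_lt_mk {α β : Omega1} {s t : Ico (0 : ℝ) 1} :
    mk α s < mk β t ↔ α < β ∨ α = β ∧ (s : ℝ) < t :=
  Prod.Lex.toLex_lt_toLex

theorem mk_le_mk {α β : Omega1} {s t : Ico (0 : ℝ) 1} :
    mk α s ≤ mk β t ↔ α < β ∨ α = β ∧ (s : ℝ) ≤ t :=
  Prod.Lex.toLex_le_toLex

theorem ofOrdinal_eq_mk (α : Omega1) : ofOrdinal α = mk α ⟨0, left_mem_Ico.2 zero_lt_one⟩ := rfl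

theorem ofOrdinal_strictMono : StrictMono ofOrdinal := fun α β h => by
  rw [ofOrdinal_eq_mk, ofOrdinal_eq_mk, mk_lt_mk]
  exact Or.inl h

theorem exists_lt_ofOrdinal (x : LongRay) : ∃ α, x < ofOrdinal α := by
  obtain ⟨α, t, rfl⟩ := exists_eq_mk x
  obtain ⟨β, h⟩ := Omega1.exists_covBy α
  exact ⟨β, mk_lt_mk.2 (Or.inl h.lt)⟩

section Coordinate

variable (c : Omega1 → ℝ)

/-- The total weight of the ordinals below `α`. -/
noncomputable def weightBelow (α : Omega1) : ℝ := ∑' γ, (Iio α).indicator c γ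

/-- The real coordinate on the long ray in which `[β, β + 1]` has length `c β`. -/
noncomputable def coordinate (x : LongRay) : ℝ :=
  weightBelow c (ofLex x).1 + (ofLex x).2 * c (ofLex x).1

variable {c}

theorem weightBelow_add_le (hc : ∀ γ, 0 ≤ c γ) (hs : Summable c) {α β : Omega1} (h : α < β) :
    weightBelow c α + c α ≤ weightBelow c β := by
  have h1 : weightBelow c α + c α = ∑' γ, (Iic α).indicator c γ := by
    rw [weightBelow, ← Iio_union_right, ← tsum_ite_eq α (fun _ => c α),
      ← (hs.indicator _).tsum_add ⟨_, hasSum_ite_eq α _⟩]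
    refine tsum_congr fun γ => ?_
    rcases lt_trichotomy γ α with h | rfl | h
    · simp [h, h.ne, indicator, h.le]
    · simp
    · simp [h.not_gt, h.ne', h.not_ge, indicator]
  rw [h1]
  refine (hs.indicator _).tsum_le_tsum (fun γ => ?_) (hs.indicator _)
  exact indicator_le_indicator_of_subset (fun γ hγ => lt_of_le_of_lt hγ h) hc γ

/-- Continuity of `weightBelow` at limits: a finite set of ordinals below `α` has a maximum `γ`, so
its weight is at most `weightBelow c γ + c γ`. The bound `0 ≤ y` serves the empty set. -/
theorem weightBelow_le (hc : ∀ γ, 0 ≤ c γ) (hs : Summable c) {α : Omega1} {y : ℝ} (hy : 0 ≤ y)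
    (h : ∀ γ < α, weightBelow c γ + c γ ≤ y) : weightBelow c α ≤ y := by
  refine (hs.indicator _).tsum_le_of_sum_le fun F => ?_
  rw [← Finset.sum_filter_add_sum_filter_not F (· < α)]
  have h0 : ∑ x ∈ F with ¬ x < α, (Iio α).indicator c x = 0 :=
    Finset.sum_eq_zero fun x hx => by simpa using fun h => absurd h (Finset.mem_filter.1 hx).2
  rw [h0, add_zero]
  rcases (F.filter (· < α)).eq_empty_or_nonempty with he | hne
  · rw [he]; simpa using hy
  · set γ := (F.filter (· < α)).max' hne
    have hγ : γ < α := (Finset.mem_filter.1 (Finset.max'_mem _ hne)).2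
    have hle : ∀ x ∈ F.filter (· < α), x ≤ γ := fun x hx => Finset.le_max' _ _ hx
    refine le_trans ?_ (h γ hγ)
    rw [weightBelow, ← Finset.sum_erase_add _ _ (Finset.max'_mem _ hne)]
    refine add_le_add ?_ (by simp [γ, hγ, indicator])
    refine le_trans (Finset.sum_le_sum fun x hx => ?_)
      ((hs.indicator (Iio γ)).sum_le_tsum ((F.filter (· < α)).erase γ)
        fun x _ => indicator_nonneg (fun _ _ => hc _) _)
    have hx' := Finset.mem_erase.1 hx
    rw [indicator_of_mem (show x ∈ Iio γ from lt_of_le_of_ne (hle x hx'.2) hx'.1)]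
    exact indicator_le_self' (fun _ _ => hc _) _

/-- Positivity strictly below `α` is enough: the only point of the segment over `α` itself is its
end point. -/
theorem coordinate_strictMonoOn (hc : ∀ γ, 0 ≤ c γ) (hs : Summable c) {α : Omega1}
    (hα : ∀ γ < α, 0 < c γ) : StrictMonoOn (coordinate c) (Iic (ofOrdinal α)) := by
  intro x _ y hy hxy
  obtain ⟨a, s, rfl⟩ := exists_eq_mk x
  obtain ⟨b, t, rfl⟩ := exists_eq_mk y
  rw [mem_Iic, ofOrdinal_eq_mk, mk_le_mk] at hy
  change weightBelow c a + s * c a < weightBelow c b + t * c b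
  have hs1 := s.2.2
  have ht0 := t.2.1
  rcases mk_lt_mk.1 hxy with h | ⟨rfl, h⟩
  · have haα : a < α := by
      rcases hy with hy | ⟨rfl, -⟩
      exacts [h.trans hy, h]
    have h1 := weightBelow_add_le hc hs h
    have h2 := hα a haα
    have h3 := mul_nonneg ht0 (hc b)
    nlinarith
  · have haα : a < α := by
      rcases hy with hy | ⟨rfl, h2⟩
      · exact hy
      · exact absurd (h.trans_le h2) (not_lt.2 s.2.1)
    have h2 := hα a haα
    nlinarith

theorem coordinate_ofOrdinal (α : Omega1) : coordinate c (ofOrdinal α) = weightBelow c α := by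
  simp [coordinate, ofOrdinal]

theorem exists_coordinate_eq (hc : ∀ γ, 0 ≤ c γ) (hs : Summable c) {α : Omega1}
    (hα : ∀ γ < α, 0 < c γ) {y : ℝ} (hy0 : 0 ≤ y) (hy : y ≤ weightBelow c α) :
    ∃ x ≤ ofOrdinal α, coordinate c x = y := by
  rcases hy.lt_or_eq with hy | rfl
  swap
  · exact ⟨_, le_rfl, coordinate_ofOrdinal α⟩
  have hne : ∃ γ < α, y < weightBelow c γ + c γ := by
    by_contra! h
    exact hy.not_ge (weightBelow_le hc hs hy0 h)
  -- The least such `γ` is the unit segment containing `y`: minimality gives `weightBelow c γ ≤ y`,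
  -- and the second coordinate solves a linear equation.
  obtain ⟨γ, ⟨hγα, hγ⟩, hmin⟩ := WellFounded.has_min (wellFounded_lt (α := Omega1))
    {γ | γ < α ∧ y < weightBelow c γ + c γ} hne
  have hle : weightBelow c γ ≤ y := weightBelow_le hc hs hy0 fun δ hδ => by
    by_contra! h
    exact hmin δ ⟨hδ.trans hγα, h⟩ hδ
  have hpos := hα γ hγα
  refine ⟨mk γ ⟨(y - weightBelow c γ) / c γ, div_nonneg (by linarith) hpos.le,
    (div_lt_one hpos).2 (by linarith)⟩, mk_le_mk.2 (Or.inl hγα), ?_⟩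
  change weightBelow c γ + (y - weightBelow c γ) / c γ * c γ = y
  field_simp
  ring

end Coordinate

/-- Initial segments of the long ray are homeomorphic to compact real intervals. -/
theorem exists_homeomorph_Icc (α : Omega1) :
    ∃ T : ℝ, 0 ≤ T ∧ Nonempty (Iic (ofOrdinal α) ≃ₜ Icc 0 T) := by
  -- Only countably many ordinals lie below `α`, so they carry positive summable weights; extend by
  -- zero.
  obtain ⟨c, hc, hα, hs⟩ : ∃ c : Omega1 → ℝ, (∀ γ, 0 ≤ c γ) ∧ (∀ γ < α, 0 < c γ) ∧
      Summable c := by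
    obtain ⟨ε, hε, T, hT, -⟩ := (Omega1.countable_Iio α).exists_pos_hasSum_le one_pos
    refine ⟨(Iio α).indicator ε, fun γ => indicator_nonneg (fun _ _ => (hε _).le) _, fun γ hγ => ?_,
      (summable_subtype_iff_indicator).1 hT.summable⟩
    rw [indicator_of_mem (by exact hγ)]
    exact hε γ
  have hmono := coordinate_strictMonoOn hc hs hα
  have hnn : ∀ β, 0 ≤ weightBelow c β := fun β => tsum_nonneg fun γ =>
    indicator_nonneg (fun _ _ => hc _) _
  have hmem (x : Iic (ofOrdinal α)) : coordinate c x ∈ Icc 0 (weightBelow c α) :=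
    ⟨add_nonneg (hnn _) (mul_nonneg (ofLex x.1).2.2.1 (hc _)),
      (hmono.monotoneOn x.2 self_mem_Iic x.2).trans_eq (coordinate_ofOrdinal α)⟩
  let e : Iic (ofOrdinal α) ≃o Icc 0 (weightBelow c α) :=
    StrictMono.orderIsoOfSurjective (fun x => ⟨coordinate c x, hmem x⟩)
      (fun x y hxy => hmono x.2 y.2 hxy) fun y => by
        obtain ⟨x, hx, h⟩ := exists_coordinate_eq hc hs hα y.2.1 y.2.2
        exact ⟨⟨x, hx⟩, Subtype.ext h⟩
  exact ⟨_, hnn α, ⟨e.toHomeomorph⟩⟩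

instance tietzeExtension_Iic (α : Omega1) : TietzeExtension.{u} (Iic (ofOrdinal α)) := by
  obtain ⟨T, hT, ⟨e⟩⟩ := exists_homeomorph_Icc α
  have : TietzeExtension.{u} (Icc 0 T) :=
    TietzeExtension.of_retract (Z := ℝ) ⟨Subtype.val, continuous_subtype_val⟩
      ⟨projIcc 0 T hT, continuous_projIcc⟩ (by ext x; simp)
  exact TietzeExtension.of_homeo e

/-- By compactness `f` is bounded, so it lands in an initial segment, where Tietze's theorem
applies. -/
theorem exists_restrict_eq {B : Type u} [TopologicalSpace B] [CompactSpace B] [NormalSpace B]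
    {s : Set B} (hs : IsClosed s) (f : C(s, LongRay)) : ∃ g : C(B, LongRay), g.restrict s = f := by
  have : CompactSpace s := isCompact_iff_compactSpace.1 hs.isCompact
  obtain ⟨b, hb⟩ := (isCompact_range f.continuous).bddAbove
  obtain ⟨α, hα⟩ := exists_lt_ofOrdinal b
  obtain ⟨g, -, hg⟩ := f.exists_forall_mem_restrict_eq hs (t := Iic (ofOrdinal α))
    fun x => (hb ⟨x, rfl⟩).trans hα.le
  exact ⟨g, hg⟩

open unitInterval in
/-- The homotopy extension property for maps from a compact space to the long ray, with the end
of the homotopy fixed to be `0`. -/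
theorem exists_extend_path {B : Type u} [TopologicalSpace B] [CompactSpace B] [T2Space B]
    {S : Set B} (hS : IsClosed S) (φ : C(B, LongRay)) {F : B → C(I, LongRay)}
    (hF : ContinuousOn F S) (h0 : ∀ b ∈ S, F b 0 = φ b) (h1 : ∀ b ∈ S, F b 1 = 0) :
    ∃ G : C(B, C(I, LongRay)), EqOn G F S ∧ ∀ b, G b 0 = φ b ∧ G b 1 = 0 := by
  classical
  -- The prescribed data on the closed set `B × {0} ∪ B × {1} ∪ S × I`; `h0` and `h1` give agreement
  -- on overlaps. Its values elsewhere are irrelevant.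
  let h : B × I → LongRay := fun p => if p.2 = 0 then φ p.1 else if p.2 = 1 then 0 else F p.1 p.2
  let A0 : Set (B × I) := {p | p.2 = 0}
  let A1 : Set (B × I) := {p | p.2 = 1}
  let A2 : Set (B × I) := {p | p.1 ∈ S}
  have hA0 : IsClosed A0 := isClosed_singleton.preimage continuous_snd
  have hA1 : IsClosed A1 := isClosed_singleton.preimage continuous_snd
  have hA2 : IsClosed A2 := hS.preimage continuous_fst
  have e0 : ∀ p ∈ A0, h p = φ p.1 := fun p hp => if_pos hp
  have e1 : ∀ p ∈ A1, h p = 0 := fun p (hp : p.2 = 1) => by simp [h, hp]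
  have e2 : ∀ p ∈ A2, h p = F p.1 p.2 := fun p (hp : p.1 ∈ S) => by
    by_cases hp0 : p.2 = 0
    · simp [h, hp0, h0 _ hp]
    · by_cases hp1 : p.2 = 1
      · simp [h, hp1, h1 _ hp]
      · simp [h, hp0, hp1]
  have c0 : ContinuousOn h A0 :=
    ((φ.continuous.comp continuous_fst).continuousOn).congr e0
  have c1 : ContinuousOn h A1 := continuousOn_const.congr e1
  have c2 : ContinuousOn h A2 := by
    refine ContinuousOn.congr ?_ e2
    have : ContinuousOn (fun p : B × I => F p.1) A2 := hF.comp continuousOn_fst fun p hp => hp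
    exact continuous_eval.comp_continuousOn (this.prodMk continuousOn_snd)
  have hA : IsClosed (A0 ∪ A1 ∪ A2) := (hA0.union hA1).union hA2
  have hh : ContinuousOn h (A0 ∪ A1 ∪ A2) :=
    (c0.union_of_isClosed c1 hA0 hA1).union_of_isClosed c2 (hA0.union hA1) hA2
  obtain ⟨g, hg⟩ := exists_restrict_eq hA ⟨_, hh.domRestrict⟩
  have hg' : ∀ p ∈ A0 ∪ A1 ∪ A2, g p = h p := fun p hp => DFunLike.congr_fun hg ⟨p, hp⟩
  refine ⟨g.curry, fun b hb => ?_, fun b => ⟨?_, ?_⟩⟩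
  · ext t
    rw [ContinuousMap.curry_apply, hg' _ (Or.inr hb), e2 _ hb]
  · rw [ContinuousMap.curry_apply, hg' _ (Or.inl (Or.inl rfl)), e0 _ rfl]
  · rw [ContinuousMap.curry_apply, hg' _ (Or.inl (Or.inr rfl)), e1 _ rfl]

end LongRay

/-! ### Maps out of CW complexes. -/

open Metric in
/-- A map out of a CW complex subject to a pointwise condition can be built cell by cell. -/
theorem CWComplex.exists_continuousMap_of_forall_cell {W : Type*} [TopologicalSpace W] [T2Space W]
    [CWComplex (univ : Set W)] {Y : Type*} [TopologicalSpace Y] [Nonempty Y] (Q : W → Y → Prop)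
    (hext : ∀ (n : ℕ) (j : RelCWComplex.cell (univ : Set W) n) (F : (Fin n → ℝ) → Y),
      ContinuousOn F (sphere 0 1) → (∀ x ∈ sphere 0 1, Q (RelCWComplex.map n j x) (F x)) →
      ∃ G : (Fin n → ℝ) → Y, ContinuousOn G (closedBall 0 1) ∧ EqOn G F (sphere 0 1) ∧
        ∀ x ∈ closedBall 0 1, Q (RelCWComplex.map n j x) (G x)) :
    ∃ F : C(W, Y), ∀ w, Q w (F w) := by
  classical
  -- Partial maps are total functions controlled only on closed cells of dimension below `n`; other
  -- values are junk.
  let Good (n : ℕ) (F : W → Y) : Prop := ∀ m < n, ∀ j : RelCWComplex.cell (univ : Set W) m,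
    ContinuousOn F (RelCWComplex.closedCell m j) ∧ ∀ w ∈ RelCWComplex.closedCell m j, Q w (F w)
  have step (n : ℕ) (F : W → Y) (hF : Good n F) : ∃ F', Good (n + 1) F' ∧
      ∀ m < n, ∀ j : RelCWComplex.cell (univ : Set W) m,
        EqOn F' F (RelCWComplex.closedCell m j) := by
    have hsphere (j : RelCWComplex.cell (univ : Set W) n) :
        ContinuousOn (fun x => F (RelCWComplex.map n j x)) (sphere 0 1) ∧
        ∀ x ∈ sphere 0 1, Q (RelCWComplex.map n j x) (F (RelCWComplex.map n j x)) := by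
      obtain ⟨J, hJ⟩ := CWComplex.mapsTo n j
      constructor
      -- Closure finiteness: the attaching sphere meets only finitely many lower cells, so
      -- continuity on each closed cell glues.
      · have hc : ContinuousOn F (⋃ m : Fin n, ⋃ i : J m, RelCWComplex.closedCell (m : ℕ) i.1) := by
          refine (locallyFinite_of_finite _).continuousOn_iUnion
            (fun m => isClosed_iUnion_of_finite fun i => RelCWComplex.isClosed_closedCell)
            fun m => (locallyFinite_of_finite _).continuousOn_iUnion
              (fun i => RelCWComplex.isClosed_closedCell) fun i => (hF m m.2 i.1).1
        refine hc.comp ((RelCWComplex.continuousOn n j).mono sphere_subset_closedBall) fun x hx => ?_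
        have := hJ hx
        simp only [mem_iUnion] at this ⊢
        obtain ⟨m, hm, i, hi, h⟩ := this
        exact ⟨⟨m, hm⟩, ⟨i, hi⟩, h⟩
      · intro x hx
        have := hJ hx
        simp only [mem_iUnion] at this
        obtain ⟨m, hm, i, hi, h⟩ := this
        exact (hF m hm i).2 _ h
    choose G hGc hGs hGQ using fun j => hext n j _ (hsphere j).1 (hsphere j).2
    let F' : W → Y := fun w => if h : ∃ j, w ∈ RelCWComplex.openCell (C := univ) n j then
      G h.choose ((RelCWComplex.map n h.choose).symm w) else F w
    have hlow (m : ℕ) (hm : m < n) (j : RelCWComplex.cell (univ : Set W) m) :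
        EqOn F' F (RelCWComplex.closedCell m j) := by
      intro w hw
      refine dif_neg ?_
      rintro ⟨i, hi⟩
      refine (RelCWComplex.disjoint_skeletonLT_openCell (n := (m : ℕ∞) + 1) (j := i) ?_).le_bot
        ⟨RelCWComplex.closedCell_subset_skeletonLT m j hw, hi⟩
      exact_mod_cast hm
    have hmap (j : RelCWComplex.cell (univ : Set W) n) (x : Fin n → ℝ) (hx : x ∈ closedBall 0 1) :
        F' (RelCWComplex.map n j x) = G j x := by
      by_cases hb : x ∈ ball 0 1
      · have h : ∃ i, RelCWComplex.map n j x ∈ RelCWComplex.openCell (C := univ) n i :=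
          ⟨j, x, hb, rfl⟩
        have hj : h.choose = j := by
          have := RelCWComplex.eq_of_not_disjoint_openCell
            (not_disjoint_iff.2 ⟨_, h.choose_spec, ⟨x, hb, rfl⟩⟩)
          simpa using this
        have : F' (RelCWComplex.map n j x) =
          G h.choose ((RelCWComplex.map n h.choose).symm (RelCWComplex.map n j x)) := dif_pos h
        rw [this, hj, (RelCWComplex.map n j).left_inv (by rwa [RelCWComplex.source_eq])]
      · have hs : x ∈ sphere (0 : Fin n → ℝ) 1 := by
          rw [mem_sphere]
          exact le_antisymm hx (not_lt.1 hb)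
        obtain ⟨J, hJ⟩ := CWComplex.mapsTo n j
        have := hJ hs
        simp only [mem_iUnion] at this
        obtain ⟨m, hm, i, hi, h⟩ := this
        rw [hlow m hm i h]
        exact (hGs j hs).symm
    refine ⟨F', fun m hm j => ?_, hlow⟩
    rcases (Nat.lt_succ_iff.1 hm).lt_or_eq with hm | rfl
    · exact ⟨(hF m hm j).1.congr (hlow m hm j), fun w hw => by
        rw [hlow m hm j hw]; exact (hF m hm j).2 w hw⟩
    · constructor
      -- A continuous surjection from a compact ball onto a Hausdorff cell is a quotient map, so
      -- continuity can be checked on the ball.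
      · have hq : IsQuotientMap (fun x : closedBall (0 : Fin m → ℝ) 1 =>
            (⟨RelCWComplex.map m j x, x, x.2, rfl⟩ : RelCWComplex.closedCell (C := univ) m j)) := by
          have hcont : Continuous (fun x : closedBall (0 : Fin m → ℝ) 1 =>
            (⟨RelCWComplex.map m j x, x, x.2, rfl⟩ : RelCWComplex.closedCell (C := univ) m j)) :=
            (RelCWComplex.continuousOn m j).domRestrict.subtype_mk _
          refine hcont.isClosedMap.isQuotientMap hcont ?_
          rintro ⟨_, x, hx, rfl⟩
          exact ⟨⟨x, hx⟩, rfl⟩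
        rw [continuousOn_iff_continuous_domRestrict, hq.continuous_iff]
        exact (hGc j).domRestrict.congr fun x => (hmap j x x.2).symm
      · rintro _ ⟨x, hx, rfl⟩
        rw [hmap j x hx]
        exact hGQ j x hx
  choose! next hnext hagree using step
  let seq : ℕ → W → Y := fun n => Nat.rec (fun _ => Classical.arbitrary Y) next n
  have hgood (n : ℕ) : Good n (seq n) := by
    induction n with
    | zero => exact fun m hm => absurd hm (Nat.not_lt_zero m)
    | succ n ih => exact hnext n _ ih
  have hstable (m : ℕ) (j : RelCWComplex.cell (univ : Set W) m) (k : ℕ) (hk : m + 1 ≤ k) :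
      EqOn (seq k) (seq (m + 1)) (RelCWComplex.closedCell m j) := by
    induction k, hk using Nat.le_induction with
    | base => exact eqOn_refl _ _
    | succ k hk ih => exact (hagree k _ (hgood k) m hk j).trans ih
  have hcover (w : W) : ∃ (n : ℕ) (j : RelCWComplex.cell (univ : Set W) n),
      w ∈ RelCWComplex.closedCell n j := by
    have : w ∈ ⋃ (n : ℕ) (j : RelCWComplex.cell (univ : Set W) n), RelCWComplex.closedCell n j := by
      rw [CWComplex.union]; trivial
    simpa using this
  choose dim c hc using hcover
  -- On a closed `m`-cell the sequence is constant from index `m + 1` on, so the choice of cell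
  -- containing `w` does not matter.
  let F : W → Y := fun w => seq (dim w + 1) w
  have hF (m : ℕ) (j : RelCWComplex.cell (univ : Set W) m) :
      EqOn F (seq (m + 1)) (RelCWComplex.closedCell m j) := fun w hw =>
    ((hstable _ (c w) (max (dim w + 1) (m + 1)) (le_max_left _ _) (hc w)).symm.trans
      (hstable m j (max (dim w + 1) (m + 1)) (le_max_right _ _) hw))
  refine ⟨⟨F, continuous_iff_isClosed.2 fun K hK => ?_⟩, fun w => ?_⟩
  · refine (CWComplex.closed univ _ (subset_univ _)).2 fun n j => ?_
    rw [inter_comm]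
    exact (((hgood (n + 1) n n.lt_succ_self j).1.congr (hF n j)).preimage_isClosed_of_isClosed
      RelCWComplex.isClosed_closedCell hK)
  · exact (hgood (dim w + 1) _ (Nat.lt_succ_self _) (c w)).2 w (hc w)

open unitInterval in
open Metric in
/-- Every map from a CW complex to the long ray is null-homotopic. -/
theorem LongRay.homotopic_zero_of_cwComplex {W : Type*} [TopologicalSpace W] [T2Space W]
    [CWComplex (univ : Set W)] (φ : C(W, LongRay)) :
    φ.Homotopic (ContinuousMap.const W 0) := by
  -- A null-homotopy is a map into the path space with prescribed end points, which is a pointwise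
  -- condition.
  obtain ⟨F, hF⟩ := CWComplex.exists_continuousMap_of_forall_cell
    (Y := C(I, LongRay)) (fun w γ => γ 0 = φ w ∧ γ 1 = 0) fun n j F hF hQ => by
      let S : Set (closedBall (0 : Fin n → ℝ) 1) := Subtype.val ⁻¹' sphere 0 1
      have : CompactSpace (closedBall (0 : Fin n → ℝ) 1) :=
        isCompact_iff_compactSpace.1 (isCompact_closedBall _ _)
      obtain ⟨G, hGF, hG⟩ := LongRay.exists_extend_path (S := S)
        (isClosed_sphere.preimage continuous_subtype_val)
        ⟨fun x => φ (RelCWComplex.map n j x),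
          φ.continuous.comp (RelCWComplex.continuousOn n j).domRestrict⟩
        (F := fun x => F x) (hF.comp continuous_subtype_val.continuousOn fun x hx => hx)
        (fun b hb => (hQ b hb).1) (fun b hb => (hQ b hb).2)
      classical
      let G' : (Fin n → ℝ) → C(I, LongRay) :=
        fun x => if h : x ∈ closedBall 0 1 then G ⟨x, h⟩ else F x
      have hG' (x) (h : x ∈ closedBall 0 1) : G' x = G ⟨x, h⟩ := dif_pos h
      refine ⟨G', ?_, fun x hx => ?_, fun x hx => ?_⟩
      · rw [continuousOn_iff_continuous_domRestrict]
        exact G.continuous.congr fun x => (hG' x x.2).symm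
      · rw [hG' x (sphere_subset_closedBall hx)]
        exact hGF hx
      · rw [hG' x hx]
        exact hG _
  exact ⟨⟨⟨fun p => F p.2 p.1, by fun_prop⟩, fun w => (hF w).1, fun w => (hF w).2⟩⟩

/-! ### An unbounded map from a Type I space to the long ray. -/

/-- A Lindelöf-closed open set that contains the closure of another one separates it from the
complement by a continuous function. -/
theorem exists_urysohn_of_isLindelof {X : Type*} [TopologicalSpace X] [RegularSpace X]
    {A V O : Set X} (hA : IsClosed A) (hAV : A ⊆ V) (hV : IsOpen V) (hVO : closure V ⊆ O)
    (hO : IsOpen O) (hL : IsLindelof (closure O)) :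
    ∃ u : C(X, ℝ), (∀ x ∈ A, u x = 0) ∧ (∀ x ∉ V, u x = 1) ∧ ∀ x, u x ∈ Icc (0 : ℝ) 1 := by
  classical
  have : LindelofSpace (closure O) := isLindelof_iff_lindelofSpace.1 hL
  -- `closure O` is regular and Lindelöf, hence normal. The function `f` is `1` off `V`, so its
  -- extension by `1` is continuous.
  obtain ⟨f, hf0, hf1, hf⟩ := exists_continuous_zero_one_of_isClosed
    (hA.preimage (continuous_subtype_val (p := (· ∈ closure O))))
    (hV.isClosed_compl.preimage (continuous_subtype_val (p := (· ∈ closure O))))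
    (disjoint_left.2 fun x hx hx' => hx' (hAV hx))
  let u : X → ℝ := fun x => if h : x ∈ closure O then f ⟨x, h⟩ else 1
  have hu (x) (h : x ∈ closure O) : u x = f ⟨x, h⟩ := dif_pos h
  have hu1 (x) (h : x ∉ V) : u x = 1 := by
    by_cases hx : x ∈ closure O
    · rw [hu x hx]; exact hf1 h
    · exact dif_neg hx
  refine ⟨⟨u, continuous_iff_continuousAt.2 fun x => ?_⟩, fun x hx => ?_, hu1, fun x => ?_⟩
  · by_cases hx : x ∈ closure V
    · have hc : ContinuousOn u (closure O) := by
        rw [continuousOn_iff_continuous_domRestrict]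
        exact f.continuous.congr fun x => (hu x x.2).symm
      exact hc.continuousAt (Filter.mem_of_superset (hO.mem_nhds (hVO hx)) subset_closure)
    · refine (continuousAt_const (y := (1 : ℝ))).congr ?_
      filter_upwards [isClosed_closure.isOpen_compl.mem_nhds hx] with y hy
      exact (hu1 y fun h => hy (subset_closure h)).symm
  · have : x ∈ closure O := subset_closure (hVO (subset_closure (hAV hx)))
    change u x = 0
    rw [hu x this]; exact hf0 hx
  · change u x ∈ _
    by_cases hx : x ∈ closure O
    · rw [hu x hx]; exact hf _
    · simp [u, hx]

/-- Urysohn functions for consecutive members of a Type I cover glue to a map to the long ray. -/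
theorem IsTypeICover.exists_map {X : Type*} [TopologicalSpace X] [RegularSpace X]
    {U : Omega1 → Set X} (hU : IsTypeICover U) :
    ∃ f : C(X, LongRay), ∀ α, ∀ x ∉ U α, LongRay.ofOrdinal α ≤ f x := by
  choose S hS using Omega1.exists_covBy
  have hSle {γ α : Omega1} (h : γ < α) : S γ ≤ α := not_lt.1 fun h' => (hS γ).2 h h'
  have hmono {α β : Omega1} (h : α ≤ β) : U α ⊆ U β := by
    rcases h.lt_or_eq with h | rfl
    · exact subset_closure.trans (hU.closure_subset h)
    · exact Subset.rfl
  choose u hu0 hu1 hu using fun α => exists_urysohn_of_isLindelof isClosed_closure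
    (hU.closure_subset (hS α).lt) (hU.isOpen (S α)) (hU.closure_subset (hS (S α)).lt)
    (hU.isOpen (S (S α))) (hU.isLindelof_closure (S (S α)))
  have hne (x : X) : {α | u α x < 1}.Nonempty := by
    obtain ⟨α, hα⟩ := mem_iUnion.1 (hU.iUnion_eq.symm ▸ mem_univ x)
    exact ⟨α, by simp [hu0 α x (subset_closure hα)]⟩
  -- At `x` the values `u α x` are `1` for `α < a x` and `0` for `α > a x`, so only `u (a x) x`
  -- carries information and serves as second coordinate.
  let a (x : X) : Omega1 := (wellFounded_lt (α := Omega1)).min _ (hne x)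
  have ha (x : X) : u (a x) x < 1 := (wellFounded_lt (α := Omega1)).min_mem _ (hne x)
  have hle (x : X) {α : Omega1} (h : u α x < 1) : a x ≤ α :=
    not_lt.1 ((wellFounded_lt (α := Omega1)).not_lt_min {α | u α x < 1} h)
  have hge (x : X) {α : Omega1} (h : x ∉ U α) : α ≤ a x := by
    by_contra! h'
    exact (ha x).ne (hu1 _ x fun hx => h (hmono (hSle h') hx))
  have hge' (x : X) {α : Omega1} (h : 0 < u α x) : α ≤ a x :=
    hge x fun hx => h.ne' (hu0 α x (subset_closure hx))
  let f (x : X) : LongRay := LongRay.mk (a x) ⟨u (a x) x, (hu _ x).1, ha x⟩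
  have hf : Continuous f := by
    refine OrderTopology.continuous_iff.2 fun b => ?_
    obtain ⟨α, t, rfl⟩ := LongRay.exists_eq_mk b
    constructor
    -- The single function `u α` decides this, as `0 < u α x` forces `α ≤ a x`.
    · have : f ⁻¹' Ioi (LongRay.mk α t) = {x | (t : ℝ) < u α x} := by
        ext x
        simp only [mem_preimage, mem_Ioi, mem_ofPred_eq, f, LongRay.mk_lt_mk]
        constructor
        · rintro (h | ⟨rfl, h⟩)
          · have : u α x = 1 := le_antisymm (hu α x).2 (not_lt.1 fun h' => (hle x h').not_gt h)
            rw [this]; exact t.2.2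
          · exact h
        · intro h
          rcases (hge' x (t.2.1.trans_lt h)).lt_or_eq with h' | h'
          · exact Or.inl h'
          · exact Or.inr ⟨h', by rwa [← h']⟩
      rw [this]
      exact isOpen_lt continuous_const (u α).continuous
    · have : f ⁻¹' Iio (LongRay.mk α t) = (⋃ β < α, {x | u β x < 1}) ∪ {x | u α x < (t : ℝ)} := by
        ext x
        simp only [mem_preimage, mem_Iio, mem_union, mem_iUnion, mem_ofPred_eq, f, LongRay.mk_lt_mk,
          exists_prop]
        constructor
        · rintro (h | ⟨rfl, h⟩)
          · exact Or.inl ⟨_, h, ha x⟩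
          · exact Or.inr h
        · rintro (⟨β, h, h'⟩ | h)
          · exact Or.inl ((hle x h').trans_lt h)
          · rcases (hle x (h.trans t.2.2)).lt_or_eq with h' | h'
            · exact Or.inl h'
            · exact Or.inr ⟨h', by rwa [h']⟩
      rw [this]
      exact (isOpen_biUnion fun β _ => isOpen_lt (u β).continuous continuous_const).union
        (isOpen_lt (u α).continuous continuous_const)
  refine ⟨⟨f, hf⟩, fun α x hx => LongRay.mk_le_mk.2 ?_⟩
  rcases (hge x hx).lt_or_eq with h | h
  · exact Or.inl h
  · exact Or.inr ⟨h, (hu _ x).1⟩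

/-- Otherwise `D` would be a closed subset of the Lindelöf set `closure (U α)`. -/
theorem IsTypeICover.diff_nonempty {X : Type*} [TopologicalSpace X] {U : Omega1 → Set X}
    (hU : IsTypeICover U) {D : Set X} (hD : IsClosed D) (hDL : ¬ IsLindelof D) (α : Omega1) :
    (D \ U α).Nonempty := by
  rw [Set.sdiff_nonempty]
  exact fun h => hDL ((hU.isLindelof_closure α).of_isClosed_subset hD (h.trans subset_closure))

/-! ### Homotopy invariance of unboundedness, and the conclusion. -/

open unitInterval in
/-- Unboundedness on a closed, non-Lindelöf, functionally narrow set is a homotopy invariant. -/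
theorem FunctionallyNarrow.not_bddAbove_of_homotopic {X : Type*} [TopologicalSpace X]
    {U : Omega1 → Set X} (hU : IsTypeICover U) {D : Set X} (hD : IsClosed D) (hDL : ¬ IsLindelof D)
    (hDN : FunctionallyNarrow U D) {f g : C(X, LongRay)} (hfg : f.Homotopic g)
    (hf : ¬ BddAbove (f '' D)) : ¬ BddAbove (g '' D) := by
  obtain ⟨K⟩ := hfg
  let B : Set I := {t | BddAbove (K.curry t '' D)}
  have hcont (x : X) : Continuous fun t : I => K.curry t x := by
    change Continuous fun t : I => K (t, x)
    fun_prop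
  -- Countably many bounds have a common bound below `ω₁`, which passes to the limit pointwise.
  have hB : IsClosed B := by
    refine IsSeqClosed.isClosed fun t t₀ ht hlim => ?_
    choose b hb using ht
    choose α hα using fun n => LongRay.exists_lt_ofOrdinal (b n)
    obtain ⟨β, hβ⟩ := Omega1.bddAbove_range α
    refine ⟨LongRay.ofOrdinal β, ?_⟩
    rintro _ ⟨x, hx, rfl⟩
    refine le_of_tendsto (((hcont x).tendsto t₀).comp hlim) (Filter.Eventually.of_forall fun n => ?_)
    exact (hb n ⟨x, hx, rfl⟩).trans ((hα n).le.trans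
      (LongRay.ofOrdinal_strictMono.monotone (hβ ⟨n, rfl⟩)))
  have hB' : IsClosed Bᶜ := by
    refine IsSeqClosed.isClosed fun t t₀ ht hlim => ?_
    rintro ⟨b, hb⟩
    obtain ⟨α, hα⟩ := LongRay.exists_lt_ofOrdinal b
    -- A single `β ≥ α` lies in the clubs of all the `t n`. A point of `D` outside `U β` is then
    -- sent to at least `β` at every `t n`, hence also at `t₀`, beyond the supposed bound.
    obtain ⟨β, hβ, hαβ⟩ := (IsClub.iInter_of_countable Omega1.cof_ne_aleph0
      fun n => hDN.isClub (K.curry (t n)) (ht n)).isCofinal α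
    obtain ⟨x, hx⟩ := hU.diff_nonempty hD hDL β
    have h1 : LongRay.ofOrdinal β ≤ K.curry t₀ x :=
      ge_of_tendsto (((hcont x).tendsto t₀).comp hlim)
        (Filter.Eventually.of_forall fun n => mem_iInter.1 hβ n ⟨x, hx, rfl⟩)
    exact (hα.trans_le (LongRay.ofOrdinal_strictMono.monotone hαβ)).not_ge
      (h1.trans (hb ⟨x, hx.1, rfl⟩))
  have h0 : K.curry 0 = f := by ext x; exact K.apply_zero x
  have h1 : K.curry 1 = g := by ext x; exact K.apply_one x
  rcases isClopen_iff.1 (⟨hB, isClosed_compl_iff.1 hB'⟩ : IsClopen B) with h | h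
  · intro hg
    have : (1 : I) ∈ B := by change BddAbove _; rwa [h1]
    rw [h] at this
    exact this
  · have : (0 : I) ∈ B := h ▸ mem_univ _
    exact absurd (h0 ▸ this : BddAbove (f '' D)) hf

theorem theorem1p5 {X : Type u} [TopologicalSpace X] [T3Space X]
    (U : Omega1 → Set X) (hU : IsTypeICover U)
    (D : Set X) (hD : IsClosed D) (hDL : ¬ IsLindelof D) (hDN : FunctionallyNarrow U D) :
    ¬ HomotopyEquivalentToCWComplex.{u, v} X := by
  rintro ⟨W, _, _, ⟨_⟩, ⟨e⟩⟩
  obtain ⟨s, hs⟩ := hU.exists_map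
  have hsD : ¬ BddAbove (s '' D) := by
    rintro ⟨b, hb⟩
    obtain ⟨α, hα⟩ := LongRay.exists_lt_ofOrdinal b
    obtain ⟨x, hx⟩ := hU.diff_nonempty hD hDL α
    exact (hα.trans_le (hs α x hx.2)).not_ge (hb ⟨x, hx.1, rfl⟩)
  -- Up to homotopy `s` factors through `W`, where its factor `s.comp e.invFun` is null-homotopic.
  have h1 : (s.comp (e.invFun.comp e.toFun)).Homotopic s :=
    (ContinuousMap.Homotopic.refl s).comp e.left_inv
  have h2 := (LongRay.homotopic_zero_of_cwComplex (s.comp e.invFun)).comp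
    (ContinuousMap.Homotopic.refl e.toFun)
  refine hDN.not_bddAbove_of_homotopic hU hD hDL (h1.symm.trans h2) hsD ⟨0, ?_⟩
  rintro _ ⟨x, -, rfl⟩
  exact le_rfl
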